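/- Let $X$ be a real Banach space with continuous dual $X^*$, and let $C\subseteq X$ be a closed convex set whose strong quasi relative interior $$\mathrm{sqri}(C)=\{x\in C:\ \mathrm{cone}(C-x)\ \text{is a closed linear subspace of } X\},\qquad \mathrm{cone}(U)=\bigcup_{\lambda\ge 0}\lambda U,$$ is nonempty. Let $F:C\times C\to\mathbb{R}$ satisfy $F(x,x)=0$ for all $x\in C$ and be monotone, i.e. $F(x,y)+F(y,x)\le 0$ for all $x,y\in C$. Assume that for every $x\in C$ the function $F(x,\cdot)$ is convex and lower semicontinuous on $C$, and that for every $y\in C$ the function $F(\cdot,y)$ is upper hemicontinuous on $C$, i.e. upper semicontinuous on every line segment contained in $C$. Then $F$ is a maximal monotone bifunction; that is, the operator $A^F:X\rightrightarrows X^*$ defined by $$A^F(x)=\{x^*\in X^*:\ F(x,y)-F(x,x)\ge\langle x^*,y-x\rangle\ \text{for all } y\in C\}\quad (x\in C),\qquad A^F(x)=\emptyset\quad (x\notin C),$$ is maximal monotone: $\langle y^*-x^*,y-x\rangle\ge 0$ whenever $x^*\in A^F(x)$ and $y^*\in A^F(y)$, and the graph $\{(x,x^*): x^*\in A^F(x)\}$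 is not properly contained in the graph of any other operator $X\rightrightarrows X^*$ with this property. -/

import Mathlib

namespace MaxMonBifunction

/-- The conical hull `⋃_{r ≥ 0} r U` of a set `U`. -/
def cone {X : Type*} [AddCommGroup X] [Module ℝ X] (U : Set X) : Set X :=
  {z | ∃ r : ℝ, 0 ≤ r ∧ ∃ u ∈ U, z = r • u}

/-- The strong quasi relative interior of a (convex) set `U`: the points `x ∈ U` such that
`cone (U - x)` is a closed linear subspace. -/
def sqri {X : Type*} [NormedAddCommGroup X] [NormedSpace ℝ X] (U : Set X) : Set X :=
  {x | x ∈ U ∧ ∃ S : Submodule ℝ X,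
    IsClosed (S : Set X) ∧ cone ((fun u : X => u - x) '' U) = (S : Set X)}

/-- `f` is upper hemicontinuous on `C`: its restriction to each line segment with endpoints in `C`
is upper semicontinuous. -/
def UpperHemicontOn {X : Type*} [NormedAddCommGroup X] [NormedSpace ℝ X]
    (f : X → ℝ) (C : Set X) : Prop :=
  ∀ a ∈ C, ∀ b ∈ C, UpperSemicontinuousOn f (segment ℝ a b)

/-- The graph of a multifunction `T : X ⇉ X*`. -/
def graph {X : Type*} [NormedAddCommGroup X] [NormedSpace ℝ X]
    (T : X → Set (StrongDual ℝ X)) : Set (X × StrongDual ℝ X) :=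
  {p | p.2 ∈ T p.1}

/-- Monotone operators `T : X ⇉ X*`. -/
def IsMonotoneOp {X : Type*} [NormedAddCommGroup X] [NormedSpace ℝ X]
    (T : X → Set (StrongDual ℝ X)) : Prop :=
  ∀ x y : X, ∀ x' ∈ T x, ∀ y' ∈ T y, 0 ≤ (y' - x') (y - x)

/-- Maximal monotone operators: monotone, and the graph is not properly included in the graph of
any monotone operator. -/
def IsMaximalMonotoneOp {X : Type*} [NormedAddCommGroup X] [NormedSpace ℝ X]
    (T : X → Set (StrongDual ℝ X)) : Prop :=
  IsMonotoneOp T ∧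
    ∀ S : X → Set (StrongDual ℝ X), IsMonotoneOp S → ¬ graph T ⊂ graph S

/-- Monotone bifunctions on `C`. A bifunction `C × C → ℝ` is given by a function `X → X → ℝ` of
which only the values on `C × C` are ever used. -/
def IsMonotoneBifun {X : Type*} (C : Set X) (F : X → X → ℝ) : Prop :=
  ∀ x ∈ C, ∀ y ∈ C, F x y + F y x ≤ 0

/-- The operator `A^F : X ⇉ X*` of a bifunction `F` on `C`; it is empty-valued off `C`. -/
def opA {X : Type*} [NormedAddCommGroup X] [NormedSpace ℝ X]
    (C : Set X) (F : X → X → ℝ) (x : X) : Set (StrongDual ℝ X) :=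
  {x' | x ∈ C ∧ ∀ y ∈ C, x' (y - x) ≤ F x y - F x x}

/-- Maximal monotone bifunctions: monotone bifunctions `F` with `A^F` maximal monotone. -/
def IsMaximalMonotoneBifun {X : Type*} [NormedAddCommGroup X] [NormedSpace ℝ X]
    (C : Set X) (F : X → X → ℝ) : Prop :=
  IsMonotoneBifun C F ∧ IsMaximalMonotoneOp (opA C F)

end MaxMonBifunction

/-!
It suffices that every pair `(x₀, x')` monotonically related to the graph of `A^F` belongs to it.

Subgradients come from one separation argument. Let `p ∈ sqri C` and let `f` be convex and lower
semicontinuous on `C`. Within the closed subspace spanned by `C - p`, the point `p` is interior to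
the sublevel sets of `f` above it, by Baire's theorem. So an affine function of slope `m` along a
ray from `p` which minorises `f` there and touches it at `y` can be separated from the epigraph of
`f`, and this gives a subgradient of `f` at `y` with slope at least `m` along the ray.

With `p = y` this yields the Minty-type inequality `x' (z - w) ≤ F w z` for `z ∈ sqri C` and
`w ∈ C ∩ [z, x₀]`: first for `w ∈ sqri C`, then in the limit by upper hemicontinuity. If
`x₀ ∉ C`, let `w` be the last point of `C` on the way from `z` to `x₀`. The ray beyond `w` avoids
`C`, and before `w` the Minty inequality bounds `F w` from below, so the slope
`m = x' (x₀ - z) + 1` is admissible and contradicts monotone relatedness at `w`. Hence `x₀ ∈ C`,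
and the Minty inequality at `w = x₀` extends from `sqri C` to `C` by convexity of `F x₀`.
-/

namespace MaxMonBifunction

open Set Filter Topology AffineMap

section AlgebraicInterior

variable {E : Type*} [AddCommGroup E] [Module ℝ E] {A C : Set E} {f : E → ℝ} {p : E}

/-- The algebraic interior (core) of `A`: the points from which one can move a positive distance
inside `A` in every direction. For the convex sets considered here this agrees with the usual
definition, which asks for a whole interval of step lengths. -/
def algInterior (A : Set E) : Set E :=
  {p | ∀ v : E, ∃ t : ℝ, 0 < t ∧ p + t • v ∈ A}

theorem algInterior_subset : algInterior A ⊆ A := fun p hp => by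
  obtain ⟨t, -, ht⟩ := hp 0
  simpa using ht

theorem mem_algInterior_sublevel (hf : ConvexOn ℝ C f) (hp : p ∈ algInterior C) {r : ℝ}
    (hr : f p < r) : p ∈ algInterior {c ∈ C | f c ≤ r} := by
  intro v
  obtain ⟨t, ht, hv⟩ := hp v
  obtain ⟨θ, hθ, hlt⟩ := exists_pos_mul_lt (sub_pos.2 hr) (max (f (p + t • v) - f p) (r - f p))
  have hθ1 : θ < 1 := by
    have := (mul_le_mul_of_nonneg_right (le_max_right _ _) hθ.le).trans_lt hlt
    rwa [mul_lt_iff_lt_one_right (sub_pos.2 hr)] at this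
  have hfθ : (f (p + t • v) - f p) * θ < r - f p :=
    (mul_le_mul_of_nonneg_right (le_max_left _ _) hθ.le).trans_lt hlt
  have hcomb : p + (θ * t) • v = (1 - θ) • p + θ • (p + t • v) := by module
  have hθ0 : 0 ≤ 1 - θ := by linarith
  have hpC := algInterior_subset hp
  refine ⟨θ * t, by positivity, hcomb ▸ hf.1 hpC hv hθ0 hθ.le (by ring), ?_⟩
  calc f (p + (θ * t) • v) ≤ (1 - θ) • f p + θ • f (p + t • v) :=
        hcomb ▸ hf.2 hpC hv hθ0 hθ.le (by ring)
    _ ≤ r := by simp only [smul_eq_mul]; linarith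

variable [TopologicalSpace E] [IsTopologicalAddGroup E] [ContinuousConstSMul ℝ E] [BaireSpace E]

theorem interior_nonempty_of_mem_algInterior (hA : Convex ℝ A) (hcl : IsClosed A)
    (hp : p ∈ algInterior A) : (interior A).Nonempty := by
  have hpos (n : ℕ) : (0 : ℝ) < 1 / (n + 1) := Nat.one_div_pos_of_nat
  let φ (n : ℕ) : E ≃ₜ E :=
    (Homeomorph.smulOfNeZero (1 / ((n : ℝ) + 1)) (hpos n).ne').trans (Homeomorph.addLeft p)
  have hcover : ⋃ n, φ n ⁻¹' A = univ := by
    refine eq_univ_of_forall fun v => ?_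
    obtain ⟨t, ht, hv⟩ := hp v
    obtain ⟨n, hn⟩ := exists_nat_one_div_lt ht
    have := hA.add_smul_mem (algInterior_subset hp) hv (t := 1 / ((n : ℝ) + 1) / t)
      ⟨(div_pos (hpos n) ht).le, (div_le_one ht).2 hn.le⟩
    rw [smul_smul, div_mul_cancel₀ _ ht.ne'] at this
    exact mem_iUnion.2 ⟨n, this⟩
  obtain ⟨n, v, hv⟩ :=
    nonempty_interior_of_iUnion_of_closed (fun n => hcl.preimage (φ n).continuous) hcover
  rw [← (φ n).preimage_interior] at hv
  exact ⟨φ n v, hv⟩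

theorem algInterior_subset_interior (hA : Convex ℝ A) (hcl : IsClosed A) :
    algInterior A ⊆ interior A := by
  intro p hp
  obtain ⟨u, hu⟩ := interior_nonempty_of_mem_algInterior hA hcl hp
  obtain ⟨t, ht, hmem⟩ := hp (p - u)
  refine hA.openSegment_interior_self_subset_interior hu hmem
    ⟨t / (1 + t), 1 / (1 + t), by positivity, by positivity, by field, ?_⟩
  match_scalars <;> field

theorem mem_interior_epigraph (hcl : IsClosed C) (hf : ConvexOn ℝ C f)
    (hlsc : LowerSemicontinuousOn f C) (hp : p ∈ algInterior C) {r : ℝ} (hr : f p < r) :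
    (p, r) ∈ interior {q : E × ℝ | q.1 ∈ C ∧ f q.1 ≤ q.2} := by
  obtain ⟨a, hpa, har⟩ := exists_between hr
  have hsub : p ∈ interior {c ∈ C | f c ≤ a} := by
    refine algInterior_subset_interior (hf.convex_le a) ?_ (mem_algInterior_sublevel hf hp hpa)
    obtain ⟨v, hv, hCv⟩ := lowerSemicontinuousOn_iff_preimage_Iic.1 hlsc a
    exact (hCv ▸ hcl.inter hv : IsClosed (C ∩ f ⁻¹' Iic a))
  refine mem_interior.2 ⟨interior {c ∈ C | f c ≤ a} ×ˢ Ioi a, ?_,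
    isOpen_interior.prod isOpen_Ioi, hsub, har⟩
  rintro q ⟨hq, haq⟩
  exact ⟨(interior_subset hq).1, (interior_subset hq).2.trans (le_of_lt haq)⟩

end AlgebraicInterior

section Subdifferential

theorem lt_of_mem_interior_epigraph {E : Type*} [TopologicalSpace E] {C : Set E} {f : E → ℝ}
    {q : E × ℝ}
    (hq : q ∈ interior {q : E × ℝ | q.1 ∈ C ∧ f q.1 ≤ q.2}) : f q.1 < q.2 := by
  have hslice : (fun s : ℝ => (q.1, s)) ⁻¹' {q : E × ℝ | q.1 ∈ C ∧ f q.1 ≤ q.2} ⊆ Ici (f q.1) :=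
    fun _ hs => hs.2
  have hcont : Continuous fun s : ℝ => (q.1, s) := by fun_prop
  have hmem : q.2 ∈ interior (Ici (f q.1)) :=
    interior_mono hslice (preimage_interior_subset_interior_preimage hcont hq)
  rwa [interior_Ici] at hmem

variable {E : Type*} [AddCommGroup E] [Module ℝ E] [TopologicalSpace E] {C : Set E} {f : E → ℝ}

/-- The subdifferential at `y` of the function equal to `f` on `C` and to `+∞` off `C`. -/
def subdifferentialOn (C : Set E) (f : E → ℝ) (y : E) : Set (StrongDual ℝ E) :=
  {ν | ∀ c ∈ C, ν (c - y) ≤ f c - f y}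

variable [IsTopologicalAddGroup E] [ContinuousSMul ℝ E]

/- A separating hyperplane of `K` and the epigraph is not vertical, because it has on its two
sides points of the same vertical line, one of them interior to the epigraph. -/
theorem exists_affine_between (hf : ConvexOn ℝ C f) {K : Set (E × ℝ)} (hK : Convex ℝ K)
    (hKf : ∀ q ∈ K, q.1 ∈ C → q.2 ≤ f q.1) {k : E × ℝ} (hkK : k ∈ K) {r : ℝ}
    (hkr : (k.1, r) ∈ interior {q : E × ℝ | q.1 ∈ C ∧ f q.1 ≤ q.2}) :
    ∃ (ν : StrongDual ℝ E) (b : ℝ), (∀ c ∈ C, ν c + b ≤ f c) ∧ ∀ q ∈ K, q.2 ≤ ν q.1 + b := by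
  set epi : Set (E × ℝ) := {q | q.1 ∈ C ∧ f q.1 ≤ q.2}
  have hdisj : Disjoint (interior epi) K := Set.disjoint_left.2 fun q hq hqK =>
    (lt_of_mem_interior_epigraph hq).not_ge (hKf q hqK (interior_subset hq).1)
  obtain ⟨g, u, hg, hgepi, hgK⟩ := geometric_hahn_banach_of_nonempty_interior
    hf.convex_epigraph hK hdisj ⟨_, hkr⟩ ⟨k, hkK⟩
  have hsplit (c : E) (s : ℝ) : g (c, s) = g (c, 0) + s * g (0, 1) := by
    rw [← smul_eq_mul, ← map_smul, ← map_add]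
    simp
  have hlt : g (k.1, r) < u := by
    have hsub : g '' epi ⊆ Iic u := image_subset_iff.2 fun q hq => hgepi q hq
    have : g (k.1, r) ∈ interior (Iic u) :=
      interior_mono hsub
        ((g.isOpenMap_of_ne_zero hg).image_interior_subset _ (mem_image_of_mem g hkr))
    rwa [interior_Iic] at this
  have hβ : 0 < -g (0, 1) := by
    have hrk : k.2 < r :=
      (hKf k hkK (interior_subset hkr).1).trans_lt (lt_of_mem_interior_epigraph hkr)
    have := hlt.trans_le (hgK k hkK)
    rw [← Prod.mk.eta (p := k), hsplit, hsplit k.1 k.2] at this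
    nlinarith
  have hν (c : E) : ((-g (0, 1))⁻¹ • g.comp (.inl ℝ E ℝ)) c + -((-g (0, 1))⁻¹ * u)
      = (-g (0, 1))⁻¹ * (g (c, 0) - u) := by
    simp only [smul_apply, ContinuousLinearMap.comp_apply, ContinuousLinearMap.inl_apply,
      smul_eq_mul]
    ring
  refine ⟨(-g (0, 1))⁻¹ • g.comp (.inl ℝ E ℝ), -((-g (0, 1))⁻¹ * u), fun c hc => ?_,
    fun q hq => ?_⟩
  · have := hgepi (c, f c) ⟨hc, le_rfl⟩
    rw [hsplit] at this
    rw [hν, inv_mul_le_iff₀ hβ]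
    linarith
  · have := hgK q hq
    rw [← Prod.mk.eta (p := q), hsplit] at this
    rw [hν, le_inv_mul_iff₀ hβ]
    linarith

variable {p d y : E} {m σ : ℝ}

theorem exists_mem_subdifferentialOn_of_ray [BaireSpace E] (hcl : IsClosed C)
    (hf : ConvexOn ℝ C f) (hlsc : LowerSemicontinuousOn f C) (hp : p ∈ algInterior C)
    (hσ : 0 ≤ σ) (hy : y = p + σ • d) (hyC : y ∈ C)
    (hray : ∀ s, 0 ≤ s → p + s • d ∈ C → f y + (s - σ) * m ≤ f (p + s • d)) :
    ∃ ν ∈ subdifferentialOn C f y, m ≤ ν d := by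
  let ray (s : ℝ) : E × ℝ := (p + s • d, f y + (s - σ) * m)
  have hray_eq : ray = lineMap (ray 0) (ray 1) := by
    ext s <;> simp only [ray, lineMap_apply_module, Prod.fst_add, Prod.snd_add, Prod.smul_fst,
      Prod.smul_snd, smul_eq_mul]
    · module
    · ring
  have hconv : Convex ℝ (ray '' Ici 0) := hray_eq ▸ (convex_Ici 0).affine_image _
  obtain ⟨ν, b, hνf, hνray⟩ := exists_affine_between hf hconv (forall_mem_image.2 hray)
    (k := ray 0) ⟨0, self_mem_Ici, rfl⟩
    (by simpa [ray] using mem_interior_epigraph hcl hf hlsc hp (lt_add_one _))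
  have hyray := hνray (ray σ) ⟨σ, hσ, rfl⟩
  have hdray := hνray (ray (σ + 1)) ⟨σ + 1, by simp only [mem_Ici]; linarith, rfl⟩
  have hyf := hνf y hyC
  simp only [ray, add_smul, one_smul, ← add_assoc, ← hy, map_add] at hyray hdray
  refine ⟨ν, fun c hc => ?_, by linarith⟩
  have := hνf c hc
  rw [map_sub]
  linarith

end Subdifferential
section StrongQuasiRelativeInterior

variable {X : Type*} [NormedAddCommGroup X] [NormedSpace ℝ X] {C : Set X} {p c : X}

theorem mem_sqri_iff : p ∈ sqri C ↔ ∃ S : Submodule ℝ X, IsClosed (S : Set X) ∧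
    (∀ c ∈ C, c - p ∈ S) ∧ 0 ∈ algInterior ((fun v : S => p + (v : X)) ⁻¹' C) := by
  constructor
  · rintro ⟨hp, S, hS, hcone⟩
    refine ⟨S, hS, fun c hc => ?_, fun v => ?_⟩
    · exact hcone.subset ⟨1, zero_le_one, c - p, mem_image_of_mem _ hc, (one_smul ℝ _).symm⟩
    · obtain ⟨r, hr, _, ⟨c, hc, rfl⟩, hv⟩ := hcone.superset v.2
      rcases hr.eq_or_lt with rfl | hr
      · exact ⟨1, one_pos, by simpa [hv] using hp⟩
      · exact ⟨r⁻¹, inv_pos.2 hr, by simpa [hv, hr.ne'] using hc⟩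
  · rintro ⟨S, hS, hCS, hp⟩
    refine ⟨by simpa using algInterior_subset hp, S, hS, Subset.antisymm ?_ fun v hv => ?_⟩
    · rintro _ ⟨r, -, _, ⟨c, hc, rfl⟩, rfl⟩
      exact S.smul_mem r (hCS c hc)
    · obtain ⟨t, ht, htv⟩ := hp ⟨v, hv⟩
      refine ⟨t⁻¹, (inv_pos.2 ht).le, t • v, ⟨p + t • v, by simpa using htv, by simp⟩, ?_⟩
      rw [inv_smul_smul₀ ht.ne']

theorem lineMap_mem_sqri (hC : Convex ℝ C) (hp : p ∈ sqri C) (hc : c ∈ C) {t : ℝ}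
    (ht : t ∈ Ico (0 : ℝ) 1) : lineMap p c t ∈ sqri C := by
  obtain ⟨S, hS, hCS, hcore⟩ := mem_sqri_iff.1 hp
  refine mem_sqri_iff.2 ⟨S, hS, fun b hb => ?_, fun v => ?_⟩
  · have : b - lineMap p c t = (b - p) - t • (c - p) := by rw [lineMap_apply_module']; abel
    exact this ▸ S.sub_mem (hCS b hb) (S.smul_mem t (hCS c hc))
  · obtain ⟨ε, hε, hv⟩ := hcore v
    refine ⟨(1 - t) * ε, mul_pos (sub_pos.2 ht.2) hε, ?_⟩
    have hcomb : lineMap p c t + ((1 - t) * ε) • (v : X)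
        = (1 - t) • (p + ε • (v : X)) + t • c := by
      rw [lineMap_apply_module]
      module
    simp only [mem_preimage, zero_add, Submodule.coe_smul] at hv ⊢
    exact hcomb ▸ hC hv hc (sub_nonneg.2 ht.2.le) ht.1 (sub_add_cancel 1 t)

theorem exists_strongDual_eq_zero_and_eq_one {S : Submodule ℝ X} (hS : IsClosed (S : Set X))
    {d : X} (hd : d ∉ S) : ∃ g : StrongDual ℝ X, (∀ v ∈ S, g v = 0) ∧ g d = 1 := by
  have : IsClosed (S : Set X) := hS
  obtain ⟨g, hg⟩ := SeparatingDual.exists_eq_one (R := ℝ) (x := S.mkQ d) (by simpa using hd)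
  exact ⟨g.comp S.mkQL, fun v hv => by simp [(Submodule.Quotient.mk_eq_zero S).2 hv], hg⟩

variable {f : X → ℝ} {d y : X} {m σ : ℝ} [CompleteSpace X]

theorem exists_mem_subdifferentialOn_of_ray_of_mem {S : Submodule ℝ X}
    (hS : IsClosed (S : Set X)) (hCS : ∀ c ∈ C, c - p ∈ S)
    (hp : 0 ∈ algInterior ((fun v : S => p + (v : X)) ⁻¹' C)) (hcl : IsClosed C)
    (hf : ConvexOn ℝ C f) (hlsc : LowerSemicontinuousOn f C)
    (hd : d ∈ S) (hσ : 0 ≤ σ) (hy : y = p + σ • d) (hyC : y ∈ C)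
    (hray : ∀ s, 0 ≤ s → p + s • d ∈ C → f y + (s - σ) * m ≤ f (p + s • d)) :
    ∃ ν ∈ subdifferentialOn C f y, m ≤ ν d := by
  have := hS.completeSpace_coe
  have hcont : Continuous fun v : S => p + (v : X) := by fun_prop
  have hfS : ConvexOn ℝ ((fun v : S => p + (v : X)) ⁻¹' C) fun v => f (p + (v : X)) :=
    (hf.translate_right p).comp_linearMap S.subtype
  obtain ⟨ν, hν, hmν⟩ := exists_mem_subdifferentialOn_of_ray (d := (⟨d, hd⟩ : S)) (m := m)
    (y := σ • ⟨d, hd⟩) (hcl.preimage hcont) hfS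
    (hlsc.comp hcont.continuousOn (mapsTo_preimage _ _)) hp hσ (zero_add _).symm
    (by simpa [← hy] using hyC) (by simpa [← hy] using hray)
  obtain ⟨μ, hμ, -⟩ := exists_extension_norm_eq S ν
  refine ⟨μ, fun c hc => ?_, (hμ ⟨d, hd⟩).symm ▸ hmν⟩
  have hle := hν ⟨c - p, hCS c hc⟩ (by simpa using hc)
  rw [← hμ] at hle
  simpa [hy, sub_sub] using hle

theorem exists_mem_subdifferentialOn_of_mem_sqri (hcl : IsClosed C)
    (hf : ConvexOn ℝ C f) (hlsc : LowerSemicontinuousOn f C) (hp : p ∈ sqri C)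
    (hσ : 0 ≤ σ) (hy : y = p + σ • d) (hyC : y ∈ C)
    (hray : ∀ s, 0 ≤ s → p + s • d ∈ C → f y + (s - σ) * m ≤ f (p + s • d)) :
    ∃ ν ∈ subdifferentialOn C f y, m ≤ ν d := by
  obtain ⟨S, hS, hCS, hcore⟩ := mem_sqri_iff.1 hp
  by_cases hd : d ∈ S
  · exact exists_mem_subdifferentialOn_of_ray_of_mem hS hCS hcore hcl hf hlsc hd hσ hy hyC hray
  obtain ⟨g, hgS, hgd⟩ := exists_strongDual_eq_zero_and_eq_one hS hd
  have hyp : y = p := by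
    have hσd : σ • d ∈ S := by simpa [hy] using hCS y hyC
    have hσ0 : σ = 0 := by_contra fun h => hd ((S.smul_mem_iff h).1 hσd)
    simpa [hσ0] using hy
  obtain ⟨ν, hν, -⟩ := exists_mem_subdifferentialOn_of_ray_of_mem (d := 0) (m := 0) hS hCS hcore
    hcl hf hlsc S.zero_mem le_rfl (by simpa using hyp) hyC (by simp [hyp])
  refine ⟨ν + (m - ν d) • g, fun c hc => ?_, by simp [hgd]⟩
  simpa [hgS _ (hyp ▸ hCS c hc)] using hν c hc

end StrongQuasiRelativeInterior

section Segments

variable {X : Type*} [NormedAddCommGroup X] [NormedSpace ℝ X] {C : Set X} {f g : X → ℝ} {a b : X}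

theorem UpperHemicontOn.le_of_forall_lineMap_le (hf : UpperHemicontOn f C) (ha : a ∈ C)
    (hb : b ∈ C) (hg : Continuous g)
    (hgf : ∀ t ∈ Ico (0 : ℝ) 1, g (lineMap a b t) ≤ f (lineMap a b t)) : g b ≤ f b := by
  by_contra! hlt
  obtain ⟨r, hfr, hrg⟩ := exists_between hlt
  have hIco : ∀ᶠ t in 𝓝[<] (1 : ℝ), t ∈ Ico (0 : ℝ) 1 := Ico_mem_nhdsLT one_pos
  have hlim : Tendsto (lineMap a b) (𝓝[<] (1 : ℝ)) (𝓝 b) := by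
    have hcont : Continuous (lineMap a b : ℝ → X) := lineMap_continuous
    simpa using hcont.continuousWithinAt.tendsto (x := (1 : ℝ)) (s := Iio 1)
  have hseg : ∀ᶠ t in 𝓝[<] (1 : ℝ), lineMap a b t ∈ segment ℝ a b := hIco.mono fun t ht =>
    lineMap_mem_segment ℝ a b (Ico_subset_Icc_self ht)
  have hf_lt : ∀ᶠ t in 𝓝[<] (1 : ℝ), f (lineMap a b t) < r :=
    (tendsto_nhdsWithin_iff.2 ⟨hlim, hseg⟩).eventually
      (hf a ha b hb b (right_mem_segment ℝ a b) r hfr)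
  have hg_gt : ∀ᶠ t in 𝓝[<] (1 : ℝ), r < g (lineMap a b t) :=
    ((hg.tendsto b).comp hlim).eventually_const_lt hrg
  obtain ⟨t, ht, hft, hgt⟩ := (hIco.and (hf_lt.and hg_gt)).exists
  exact (hft.trans hgt).not_ge (hgf t ht)

variable {E : Type*} [AddCommGroup E] [Module ℝ E] [TopologicalSpace E] [IsTopologicalAddGroup E]
  [ContinuousSMul ℝ E] {C : Set E} {f g : E → ℝ} {a b : E}

theorem le_of_convexOn_of_forall_lineMap_le (hf : ConvexOn ℝ C f) (ha : a ∈ C) (hb : b ∈ C)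
    (hg : Continuous g)
    (hgf : ∀ t ∈ Ico (0 : ℝ) 1, g (lineMap a b t) ≤ f (lineMap a b t)) : g b ≤ f b := by
  have hcont : Continuous fun t : ℝ => g (lineMap a b t) := hg.comp lineMap_continuous
  have hlim : Continuous fun t : ℝ => lineMap (f a) (f b) t := lineMap_continuous
  have hle : ∀ t ∈ Ico (0 : ℝ) 1, g (lineMap a b t) ≤ lineMap (f a) (f b) t := fun t ht =>
    (hgf t ht).trans <| by
      simpa only [lineMap_apply_module] using
        hf.2 ha hb (sub_nonneg.2 ht.2.le) ht.1 (sub_add_cancel 1 t)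
  simpa using le_of_tendsto_of_tendsto (hcont.continuousWithinAt (x := 1) (s := Iio 1))
    (hlim.continuousWithinAt (x := 1) (s := Iio 1))
    (mem_of_superset (Ico_mem_nhdsLT one_pos) hle)

theorem exists_last_lineMap_mem (hC : Convex ℝ C) (hcl : IsClosed C) (ha : a ∈ C) (hb : b ∉ C) :
    ∃ τ ∈ Ico (0 : ℝ) 1, (lineMap a b τ : E) ∈ C ∧
      ∀ s : ℝ, (lineMap a b s : E) ∈ C → s ≤ τ := by
  set J : Set ℝ := lineMap a b ⁻¹' C
  have hJ0 : 0 ∈ J := by simpa [J] using ha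
  have hJ1 : 1 ∉ J := by simpa [J] using hb
  have hJ_conn : J.OrdConnected := (hC.affine_preimage (lineMap a b)).ordConnected
  have hJ_bdd : ∀ s ∈ J, s ≤ 1 := fun s hs => by
    by_contra! h
    exact hJ1 (hJ_conn.out hJ0 hs ⟨zero_le_one, h.le⟩)
  have hJ_cl : IsClosed J := hcl.preimage lineMap_continuous
  have hsup : sSup J ∈ J := hJ_cl.csSup_mem ⟨0, hJ0⟩ ⟨1, hJ_bdd⟩
  exact ⟨sSup J, ⟨le_csSup ⟨1, hJ_bdd⟩ hJ0, (hJ_bdd _ hsup).lt_of_ne fun h => hJ1 (h ▸ hsup)⟩,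
    hsup, fun s hs => le_csSup ⟨1, hJ_bdd⟩ hs⟩

end Segments

section MonotoneOperators

variable {X : Type*} [NormedAddCommGroup X] [NormedSpace ℝ X] {C : Set X} {F : X → X → ℝ}
  {T : X → Set (StrongDual ℝ X)}

/-- The pair `(x, x')` is monotonically related to the graph of `T`: adding it to the graph of a
monotone operator `T` keeps the operator monotone. -/
def MonotonicallyRelated (T : X → Set (StrongDual ℝ X)) (x : X) (x' : StrongDual ℝ X) : Prop :=
  ∀ y, ∀ y' ∈ T y, 0 ≤ (y' - x') (y - x)

theorem isMaximalMonotoneOp_of_forall_related_mem (hT : IsMonotoneOp T)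
    (hmem : ∀ x x', MonotonicallyRelated T x x' → x' ∈ T x) : IsMaximalMonotoneOp T :=
  ⟨hT, fun _ hS hTS => hTS.2 fun q hq =>
    hmem q.1 q.2 fun y y' hy' => hS q.1 y q.2 hq y' (hTS.subset (show (y, y') ∈ graph T from hy'))⟩

theorem isMonotoneOp_opA (hdiag : ∀ x ∈ C, F x x = 0) (hF : IsMonotoneBifun C F) :
    IsMonotoneOp (opA C F) := by
  rintro x y x' ⟨hx, hx'⟩ y' ⟨hy, hy'⟩
  have hxy := hx' y hy
  have hyx := hy' x hx
  rw [hdiag x hx] at hxy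
  rw [hdiag y hy, ← neg_sub, map_neg] at hyx
  rw [sub_apply]
  linarith [hF x hx y hy]

variable {x₀ z w y : X} {x' : StrongDual ℝ X} {t : ℝ} [CompleteSpace X]

/- By convexity `F y` grows from `y` in the direction `y - z`, which points towards `x₀`, at rate at
least `F y y - F y z`; relatedness bounds by `x'` a subgradient of `F y` with that slope. -/
theorem MonotonicallyRelated.le_of_lineMap_mem_sqri (h : MonotonicallyRelated (opA C F) x₀ x')
    (hcl : IsClosed C) (hconv : ConvexOn ℝ C (F y)) (hlsc : LowerSemicontinuousOn (F y) C)
    (hz : z ∈ C) (ht : t ∈ Ico (0 : ℝ) 1) (hy : y = lineMap z x₀ t) (hyC : y ∈ sqri C) :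
    x' (z - y) ≤ F y z - F y y := by
  have hray (s : ℝ) (hs : 0 ≤ s) (hsC : y + s • (y - z) ∈ C) :
      F y y + (s - 0) * (F y y - F y z) ≤ F y (y + s • (y - z)) := by
    have hs1 : 0 < 1 + s := by linarith
    have hcomb : (s / (1 + s)) • z + (1 / (1 + s)) • (y + s • (y - z)) = y := by
      match_scalars <;> field
    have hle := hconv.2 hz hsC (div_nonneg hs hs1.le) (one_div_pos.2 hs1).le (by field)
    rw [hcomb, smul_eq_mul, smul_eq_mul, div_mul_eq_mul_div, div_mul_eq_mul_div, ← add_div,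
      le_div_iff₀ hs1] at hle
    linarith
  obtain ⟨ν, hν, hνd⟩ := exists_mem_subdifferentialOn_of_mem_sqri hcl hconv hlsc hyC le_rfl
    (by simp) hyC.1 hray
  have hrel := h y ν ⟨hyC.1, hν⟩
  have ht1 : 0 < 1 - t := sub_pos.2 ht.2
  have hdir : y - z = t • (x₀ - z) := by simp [hy, lineMap_apply_module']
  have hback : y - x₀ = -((1 - t) • (x₀ - z)) := by rw [hy, lineMap_apply_module]; module
  have hle : (ν - x') (x₀ - z) ≤ 0 := by
    rw [hback, map_neg, map_smul, smul_eq_mul] at hrel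
    nlinarith
  have hle' : (ν - x') (y - z) ≤ 0 := by
    rw [hdir, map_smul, smul_eq_mul]
    exact mul_nonpos_of_nonneg_of_nonpos ht.1 hle
  rw [sub_apply] at hle'
  rw [← neg_sub y z, map_neg]
  linarith

theorem MonotonicallyRelated.le_of_mem_segment (h : MonotonicallyRelated (opA C F) x₀ x')
    (hC : Convex ℝ C) (hcl : IsClosed C) (hdiag : ∀ x ∈ C, F x x = 0)
    (hconv : ∀ x ∈ C, ConvexOn ℝ C (F x)) (hlsc : ∀ x ∈ C, LowerSemicontinuousOn (F x) C)
    (husc : ∀ y ∈ C, UpperHemicontOn (fun x => F x y) C)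
    (hz : z ∈ sqri C) (hw : w ∈ C) (hwseg : w ∈ segment ℝ z x₀) : x' (z - w) ≤ F w z := by
  rw [segment_eq_image_lineMap] at hwseg
  obtain ⟨τ, hτ, rfl⟩ := hwseg
  refine (husc z hz.1).le_of_forall_lineMap_le hz.1 hw (g := fun y => x' (z - y)) (by fun_prop)
    fun t ht => ?_
  have hy := lineMap_mem_sqri hC hz hw ht
  have htτ : t * τ ∈ Ico (0 : ℝ) 1 :=
    ⟨mul_nonneg ht.1 hτ.1, (mul_le_of_le_one_right ht.1 hτ.2).trans_lt ht.2⟩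
  have hle := h.le_of_lineMap_mem_sqri hcl (hconv _ hy.1) (hlsc _ hy.1) hz.1 htτ
    (lineMap_lineMap_right z x₀ τ t) hy
  rwa [hdiag _ hy.1, sub_zero] at hle

theorem MonotonicallyRelated.mul_le_of_lineMap (h : MonotonicallyRelated (opA C F) x₀ x')
    (hC : Convex ℝ C) (hcl : IsClosed C) (hdiag : ∀ x ∈ C, F x x = 0)
    (hconv : ∀ x ∈ C, ConvexOn ℝ C (F x)) (hlsc : ∀ x ∈ C, LowerSemicontinuousOn (F x) C)
    (husc : ∀ y ∈ C, UpperHemicontOn (fun x => F x y) C) (hz : z ∈ sqri C) {s τ : ℝ}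
    (hw : lineMap z x₀ τ ∈ C) (hs : 0 ≤ s) (hsτ : s ≤ τ) (hτ : τ ≤ 1) :
    (s - τ) * x' (x₀ - z) ≤ F (lineMap z x₀ τ) (lineMap z x₀ s) := by
  rcases hsτ.eq_or_lt with rfl | hsτ
  · rw [hdiag _ hw, sub_self, zero_mul]
  have hs_sqri : lineMap z x₀ s ∈ sqri C := by
    have hτ0 : 0 < τ := hs.trans_lt hsτ
    have hmem := lineMap_mem_sqri hC hz hw ⟨div_nonneg hs hτ0.le, (div_lt_one hτ0).2 hsτ⟩
    rwa [lineMap_lineMap_right, div_mul_cancel₀ _ hτ0.ne'] at hmem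
  have hseg : lineMap z x₀ τ ∈ segment ℝ (lineMap z x₀ s) x₀ := by
    have himage := image_segment ℝ (lineMap z x₀ : ℝ →ᵃ[ℝ] X) s 1
    rw [lineMap_apply_one, segment_eq_Icc (hsτ.le.trans hτ)] at himage
    exact himage ▸ mem_image_of_mem _ ⟨hsτ.le, hτ⟩
  have hdiff : (lineMap z x₀ s - lineMap z x₀ τ : X) = (s - τ) • (x₀ - z) := by
    simp only [lineMap_apply_module']
    module
  simpa only [hdiff, map_smul, smul_eq_mul] using
    h.le_of_mem_segment hC hcl hdiag hconv hlsc husc hs_sqri hw hseg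

theorem MonotonicallyRelated.mem_of_mem_sqri (h : MonotonicallyRelated (opA C F) x₀ x')
    (hC : Convex ℝ C) (hcl : IsClosed C) (hdiag : ∀ x ∈ C, F x x = 0)
    (hconv : ∀ x ∈ C, ConvexOn ℝ C (F x)) (hlsc : ∀ x ∈ C, LowerSemicontinuousOn (F x) C)
    (husc : ∀ y ∈ C, UpperHemicontOn (fun x => F x y) C) (hz : z ∈ sqri C) : x₀ ∈ C := by
  by_contra hx₀
  obtain ⟨τ, hτ, hw, hlast⟩ := exists_last_lineMap_mem hC hcl hz.1 hx₀
  have hpoint (s : ℝ) : z + s • (x₀ - z) = lineMap z x₀ s := by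
    rw [lineMap_apply_module', add_comm]
  set w : X := lineMap z x₀ τ with hw_def
  have hray (s : ℝ) (hs : 0 ≤ s) (hsC : z + s • (x₀ - z) ∈ C) :
      F w w + (s - τ) * (x' (x₀ - z) + 1) ≤ F w (z + s • (x₀ - z)) := by
    rw [hpoint] at hsC ⊢
    have hle := h.mul_le_of_lineMap hC hcl hdiag hconv hlsc husc hz hw hs (hlast s hsC) hτ.2.le
    rw [hdiag w hw]
    linarith [hlast s hsC]
  obtain ⟨ν, hν, hνd⟩ := exists_mem_subdifferentialOn_of_mem_sqri hcl (hconv w hw) (hlsc w hw) hz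
    hτ.1 (hpoint τ).symm hw hray
  have hrel := h w ν ⟨hw, hν⟩
  have hback : w - x₀ = -((1 - τ) • (x₀ - z)) := by
    rw [hw_def, ← hpoint]
    module
  rw [hback, map_neg, map_smul, smul_eq_mul, sub_apply] at hrel
  nlinarith [hτ.2]

theorem MonotonicallyRelated.mem_opA (h : MonotonicallyRelated (opA C F) x₀ x')
    (hC : Convex ℝ C) (hcl : IsClosed C) (hsqri : (sqri C).Nonempty) (hdiag : ∀ x ∈ C, F x x = 0)
    (hconv : ∀ x ∈ C, ConvexOn ℝ C (F x)) (hlsc : ∀ x ∈ C, LowerSemicontinuousOn (F x) C)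
    (husc : ∀ y ∈ C, UpperHemicontOn (fun x => F x y) C) : x' ∈ opA C F x₀ := by
  obtain ⟨p, hp⟩ := hsqri
  have hx₀ := h.mem_of_mem_sqri hC hcl hdiag hconv hlsc husc hp
  refine ⟨hx₀, fun z hz => ?_⟩
  rw [hdiag x₀ hx₀, sub_zero]
  refine le_of_convexOn_of_forall_lineMap_le (hconv x₀ hx₀) hp.1 hz (g := fun y => x' (y - x₀))
    (by fun_prop) fun t ht => ?_
  exact h.le_of_mem_segment hC hcl hdiag hconv hlsc husc (lineMap_mem_sqri hC hp hz ht) hx₀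
    (right_mem_segment ℝ _ _)

end MonotoneOperators

end MaxMonBifunction

theorem mainTheorem2 {X : Type*} [NormedAddCommGroup X] [NormedSpace ℝ X] [CompleteSpace X]
    (C : Set X) (hCconv : Convex ℝ C) (hCclosed : IsClosed C)
    (hCsqri : (MaxMonBifunction.sqri C).Nonempty)
    (F : X → X → ℝ) (hFdiag : ∀ x ∈ C, F x x = 0)
    (hFmono : MaxMonBifunction.IsMonotoneBifun C F)
    (hFconv : ∀ x ∈ C, ConvexOn ℝ C (fun y => F x y))
    (hFlsc : ∀ x ∈ C, LowerSemicontinuousOn (fun y => F x y) C)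
    (hFusc : ∀ y ∈ C, MaxMonBifunction.UpperHemicontOn (fun x => F x y) C) :
    MaxMonBifunction.IsMaximalMonotoneBifun C F :=
  ⟨hFmono, MaxMonBifunction.isMaximalMonotoneOp_of_forall_related_mem
    (MaxMonBifunction.isMonotoneOp_opA hFdiag hFmono) fun _ _ h =>
      h.mem_opA hCconv hCclosed hCsqri hFdiag hFconv hFlsc hFusc⟩
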